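/- Let $A$ and $B$ be unital associative rings, $B\to A$ a ring morphism, and $\mathfrak C$ an $A$-coring, i.e. an $A$-$A$-bimodule with a coassociative and counital comultiplication $\Delta:\mathfrak C\to\mathfrak C\otimes_A\mathfrak C$, $\Delta(c)=c_{(1)}\otimes c_{(2)}$, and counit $\varepsilon:\mathfrak C\to A$, both $A$-bilinear. Let $\mathfrak C^*=\mathrm{Hom}_A(\mathfrak C,A)$ (right $A$-linear maps) be the ring with unit $\varepsilon$ and product $(f*g)(c)=f(g(c_{(1)})c_{(2)})$, and let ${}^*\mathfrak C={}_A\mathrm{Hom}(\mathfrak C,A)$ (left $A$-linear maps) be the ring with product $(f*g)(c)=g(c_{(1)}f(c_{(2)}))$. $\mathfrak C$ is an $A$-${}^*\mathfrak C$-bimodule through $c\cdot g=c_{(1)}g(c_{(2)})$, and ${}^*\mathfrak C$ is one through $(af)(d)=f(da)$ and its product. For a $B$-$B$-bimodule $M$ put $M^B=\{m\in M: bm=mb \text{ for all } b\in B\}$; on $\mathfrak C^*$ the bimodule structure is $(af)(c)=af(c)$, $(fa)(c)=f(ac)$. A module $M$ over a ring is locally projective if for every finitely generated submodule $F\subseteq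 M$, every surjective linear map $f:N'\to N$ and every linear map $g:M\to N$ there is a linear map $h:M\to N'$ with $g|_F=f\circ h|_F$. The coring $\mathfrak C$ is left $B$-locally quasi-Frobenius if it is locally projective as a left $A$-module and there are a set $I$ and an $A$-${}^*\mathfrak C$-bilinear map $j=(j_\ell)_{\ell\in I}:\mathfrak C\to({}^*\mathfrak C)^I$ such that, for $\tilde\jmath:\mathfrak C^{(I)}\to\mathfrak C^*$, $\tilde\jmath(z)(d)=\sum_\ell j_\ell(d)(z_\ell)$, the set $\tilde\jmath\big((\mathfrak C^{(I)})^B\big)$ is dense in $(\mathfrak C^*)^B$ for the finite topology: for every $f\in(\mathfrak C^*)^B$ and all $c_1,\dots,c_n\in\mathfrak C$ there is $z\in(\mathfrak C^{(I)})^B$ with $\tilde\jmath(z)(c_i)=f(c_i)$ for all $i$. Suppose that $\mathfrak C$ is left $B$-locally quasi-Frobenius. Then: (1) $\mathfrak C$ is locally projective as a right $A$-module, so that the left rational functor ${}_{\mathfrak C^*}\mathrm{Rat}:{}_{\mathfrak C^*}\mathcal M\to{}^{\mathfrak C}\mathcal M$ from left $\mathfrak C^*$-modules to left $\mathfrak C$-comodules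 is defined; it sends $M$ to $\{m\in M:\ \exists\, \sum_i c_i\otimes m_i\in\mathfrak C\otimes_A M,\ f\cdot m=\sum_i f(c_i)m_i\ \text{for all } f\in\mathfrak C^*\}$, with coaction $m\mapsto\sum_i c_i\otimes m_i$. This functor is exact. (2) If moreover $A$ is a quasi-Frobenius ring (artinian and self-injective on both sides), then $\mathfrak C$ is left semiperfect: every finitely generated left $\mathfrak C$-comodule (in particular every simple one) has a projective cover in ${}^{\mathfrak C}\mathcal M$, i.e. a superfluous epimorphism onto it from a projective object. -/

import Mathlib

universe u v w u' w'

open scoped TensorProduct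
open MulOpposite CategoryTheory

noncomputable section

set_option linter.unusedSectionVars false

namespace CoringTheory

section BalancedTensor

variable (A : Type*) [Ring A]

/-- The relations `m a ⊗ n = m ⊗ a n` cutting `M ⊗_A N` out of `M ⊗_ℤ N`
(right modules over `A` are modules over `Aᵐᵒᵖ`). -/
def balancedRel (M N : Type*) [AddCommGroup M] [Module Aᵐᵒᵖ M] [AddCommGroup N] [Module A N] :
    AddSubgroup (M ⊗[ℤ] N) :=
  AddSubgroup.closure {x | ∃ (m : M) (a : A) (n : N), x = (op a • m) ⊗ₜ[ℤ] n - m ⊗ₜ[ℤ] (a • n)}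

/-- The tensor product `M ⊗_A N` of a right `A`-module and a left `A`-module over a not
necessarily commutative ring. -/
def BTensor (M N : Type*) [AddCommGroup M] [Module Aᵐᵒᵖ M] [AddCommGroup N] [Module A N] :=
  (M ⊗[ℤ] N) ⧸ balancedRel A M N

namespace BTensor

variable {M N M' N' P : Type*} [AddCommGroup M] [Module Aᵐᵒᵖ M] [AddCommGroup N] [Module A N]
  [AddCommGroup M'] [Module Aᵐᵒᵖ M'] [AddCommGroup N'] [Module A N'] [AddCommGroup P]

instance : AddCommGroup (BTensor A M N) :=
  inferInstanceAs (AddCommGroup ((M ⊗[ℤ] N) ⧸ balancedRel A M N))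

/-- The quotient map `M ⊗_ℤ N → M ⊗_A N`. -/
def mk : (M ⊗[ℤ] N) →+ BTensor A M N := QuotientAddGroup.mk' (balancedRel A M N)

/-- The universal biadditive balanced map `(m, n) ↦ m ⊗ n`. -/
def tmul : M →+ N →+ BTensor A M N :=
  AddMonoidHom.mk'
    (fun m => AddMonoidHom.mk' (fun n => mk A (m ⊗ₜ[ℤ] n))
      (fun x y => by rw [TensorProduct.tmul_add, map_add]))
    (fun x y => by
      ext n
      change mk A ((x + y) ⊗ₜ[ℤ] n) = mk A (x ⊗ₜ[ℤ] n) + mk A (y ⊗ₜ[ℤ] n)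
      rw [TensorProduct.add_tmul, map_add])

theorem tmul_balanced (m : M) (a : A) (n : N) :
    tmul A (op a • m) n = tmul A m (a • n) := by
  have h : mk A ((op a • m) ⊗ₜ[ℤ] n - m ⊗ₜ[ℤ] (a • n)) = 0 :=
    (QuotientAddGroup.eq_zero_iff _).2 (AddSubgroup.subset_closure ⟨m, a, n, rfl⟩)
  rw [map_sub, sub_eq_zero] at h
  exact h

/-- The universal property of `M ⊗_A N`. -/
def lift (f : M →+ N →+ P) (hf : ∀ (m : M) (a : A) (n : N), f (op a • m) n = f m (a • n)) :
    BTensor A M N →+ P :=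
  QuotientAddGroup.lift (balancedRel A M N)
    (TensorProduct.liftAddHom f (fun r m n => by simp))
    (by
      refine (AddSubgroup.closure_le _).2 ?_
      rintro x ⟨m, a, n, rfl⟩
      simp [hf])

@[simp] theorem lift_tmul (f : M →+ N →+ P) (hf : ∀ (m : M) (a : A) (n : N), f (op a • m) n = f m (a • n))
    (m : M) (n : N) : lift A f hf (tmul A m n) = f m n := rfl

@[elab_as_elim] theorem induction {p : BTensor A M N → Prop} (t : BTensor A M N)
    (zero : p 0) (tm : ∀ m n, p (tmul A m n)) (add : ∀ x y, p x → p y → p (x + y)) : p t := by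
  obtain ⟨t, rfl⟩ := QuotientAddGroup.mk'_surjective (balancedRel A M N) t
  induction t using TensorProduct.induction_on with
  | zero => exact zero
  | tmul m n => exact tm m n
  | add x y hx hy => exact add _ _ hx hy

theorem hom_ext {f g : BTensor A M N →+ P} (h : ∀ m n, f (tmul A m n) = g (tmul A m n))
    (t : BTensor A M N) : f t = g t := by
  induction t using BTensor.induction with
  | zero => simp
  | tm m n => exact h m n
  | add x y hx hy => rw [map_add, map_add, hx, hy]

/-- `f ⊗_A g`. -/
def map (f : M →ₗ[Aᵐᵒᵖ] M') (g : N →ₗ[A] N') : BTensor A M N →+ BTensor A M' N' :=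
  lift A
    (AddMonoidHom.mk' (fun m => (tmul A (f m)).comp g.toAddMonoidHom) (fun x y => by ext; simp))
    (fun m a n => by simp [tmul_balanced])

@[simp] theorem map_tmul (f : M →ₗ[Aᵐᵒᵖ] M') (g : N →ₗ[A] N') (m : M) (n : N) :
    map A f g (tmul A m n) = tmul A (f m) (g n) := rfl

section Left
variable [Module A M] [SMulCommClass A Aᵐᵒᵖ M]

/-- Left multiplication by `a` on a bimodule, as a right linear map. -/
def lsmul (a : A) : M →ₗ[Aᵐᵒᵖ] M where
  toFun m := a • m
  map_add' := smul_add a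
  map_smul' b m := smul_comm a b m

/-- `M ⊗_A N` is a left module if `M` is a bimodule: `a (m ⊗ n) = a m ⊗ n`. -/
instance : Module A (BTensor A M N) where
  smul a t := map A (lsmul A a) LinearMap.id t
  smul_zero a := map_zero _
  smul_add a := map_add _
  one_smul t := hom_ext A (f := map A (lsmul A 1) LinearMap.id) (g := AddMonoidHom.id _)
    (fun m n => by simp [lsmul]) t
  mul_smul a b t := hom_ext A (f := map A (lsmul A (a * b)) LinearMap.id)
    (g := (map A (lsmul A a) LinearMap.id).comp (map A (lsmul A b) LinearMap.id))
    (fun m n => by simp [lsmul, mul_smul]) t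
  add_smul a b t := hom_ext A (f := map A (lsmul A (a + b)) LinearMap.id)
    (g := map A (lsmul A a) LinearMap.id + map A (lsmul A b) LinearMap.id)
    (fun m n => by simp [lsmul, add_smul]) t
  zero_smul t := hom_ext A (f := map A (lsmul A 0) LinearMap.id) (g := 0)
    (fun m n => by simp [lsmul]) t

@[simp] theorem smul_tmul (a : A) (m : M) (n : N) :
    a • tmul A m n = tmul A (a • m) n := rfl

end Left

section Right
variable [Module Aᵐᵒᵖ N] [SMulCommClass A Aᵐᵒᵖ N]

/-- Right multiplication by `a` on a bimodule, as a left linear map. -/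
def rsmul (a : Aᵐᵒᵖ) : N →ₗ[A] N where
  toFun n := a • n
  map_add' := smul_add a
  map_smul' b n := (smul_comm b a n).symm

/-- `M ⊗_A N` is a right module if `N` is a bimodule: `(m ⊗ n) a = m ⊗ n a`. -/
instance : Module Aᵐᵒᵖ (BTensor A M N) where
  smul a t := map A LinearMap.id (rsmul A a) t
  smul_zero a := map_zero _
  smul_add a := map_add _
  one_smul t := hom_ext A (f := map A LinearMap.id (rsmul A 1)) (g := AddMonoidHom.id _)
    (fun m n => by simp [rsmul]) t
  mul_smul a b t := hom_ext A (f := map A LinearMap.id (rsmul A (a * b)))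
    (g := (map A LinearMap.id (rsmul A a)).comp (map A LinearMap.id (rsmul A b)))
    (fun m n => by simp [rsmul, mul_smul]) t
  add_smul a b t := hom_ext A (f := map A LinearMap.id (rsmul A (a + b)))
    (g := map A LinearMap.id (rsmul A a) + map A LinearMap.id (rsmul A b))
    (fun m n => by simp [rsmul, add_smul]) t
  zero_smul t := hom_ext A (f := map A LinearMap.id (rsmul A 0)) (g := 0)
    (fun m n => by simp [rsmul]) t

@[simp] theorem op_smul_tmul (a : Aᵐᵒᵖ) (m : M) (n : N) :
    a • tmul A m n = tmul A m (a • n) := rfl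

end Right

section Assoc
variable {D : Type*} [AddCommGroup D] [Module A D] [Module Aᵐᵒᵖ D] [SMulCommClass A Aᵐᵒᵖ D]

/-- The triadditive map `(m, d, n) ↦ m ⊗ (d ⊗ n)`. -/
def assocCurried : M →+ D →+ N →+ BTensor A M (BTensor A D N) :=
  AddMonoidHom.mk' (fun m => AddMonoidHom.mk' (fun d => (tmul A m).comp (tmul A d))
    (fun x y => by ext n; simp)) (fun x y => by ext d n; simp)

@[simp] theorem assocCurried_apply (m : M) (d : D) (n : N) :
    assocCurried A m d n = tmul A m (tmul A d n) := rfl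

/-- The map `m ⊗ d ↦ (n ↦ m ⊗ (d ⊗ n))`. -/
def assocAux : BTensor A M D →+ N →+ BTensor A M (BTensor A D N) :=
  lift A (assocCurried A) (fun m a d => by
    ext n
    rw [assocCurried_apply, assocCurried_apply, tmul_balanced, smul_tmul])

@[simp] theorem assocAux_tmul (m : M) (d : D) (n : N) :
    assocAux A (tmul A m d) n = tmul A m (tmul A d n) := rfl

/-- The associativity map `(M ⊗_A D) ⊗_A N → M ⊗_A (D ⊗_A N)`, `(m ⊗ d) ⊗ n ↦ m ⊗ (d ⊗ n)`. -/
def assoc : BTensor A (BTensor A M D) N →+ BTensor A M (BTensor A D N) :=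
  lift A (assocAux A) (fun t a n => by
    induction t using BTensor.induction with
    | zero => simp only [smul_zero, map_zero, AddMonoidHom.zero_apply]
    | tm m d => rw [op_smul_tmul, assocAux_tmul, assocAux_tmul, tmul_balanced]
    | add x y hx hy =>
      simp only [smul_add, map_add, AddMonoidHom.add_apply, hx, hy])

@[simp] theorem assoc_tmul (m : M) (d : D) (n : N) :
    assoc A (tmul A (tmul A m d) n) = tmul A m (tmul A d n) := rfl

end Assoc

/-- `f ⊗ N : M ⊗_A N → A ⊗_A N = N`, `m ⊗ n ↦ f(m) n`. -/
def evalLeft (f : M →ₗ[Aᵐᵒᵖ] A) : BTensor A M N →+ N :=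
  lift A
    (AddMonoidHom.mk' (fun m => AddMonoidHom.mk' (fun n => f m • n) (smul_add _))
      (fun x y => by ext; simp [add_smul]))
    (fun m a n => by simp [mul_smul])

@[simp] theorem evalLeft_tmul (f : M →ₗ[Aᵐᵒᵖ] A) (m : M) (n : N) :
    evalLeft A f (tmul A m n) = f m • n := rfl

/-- `M ⊗ g : M ⊗_A N → M ⊗_A A = M`, `m ⊗ n ↦ m g(n)`. -/
def evalRight (g : N →ₗ[A] A) : BTensor A M N →+ M :=
  lift A
    (AddMonoidHom.mk' (fun m => AddMonoidHom.mk' (fun n => op (g n) • m)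
      (fun x y => by simp [add_smul])) (fun x y => by ext; simp))
    (fun m a n => by simp [mul_smul])

@[simp] theorem evalRight_tmul (g : N →ₗ[A] A) (m : M) (n : N) :
    evalRight A g (tmul A m n) = op (g n) • m := rfl

end BTensor

end BalancedTensor

open BTensor

/-- An additive map that commutes with the right action, as a right linear map. -/
def rightLin {A M M' : Type*} [Ring A] [AddCommGroup M] [Module Aᵐᵒᵖ M] [AddCommGroup M']
    [Module Aᵐᵒᵖ M'] (f : M →+ M') (h : ∀ (a : A) (m : M), f (op a • m) = op a • f m) :
    M →ₗ[Aᵐᵒᵖ] M' where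
  toFun := f
  map_add' := f.map_add
  map_smul' a m := h a.unop m

/-- An additive map that commutes with the left action, as a left linear map. -/
def leftLin {A M M' : Type*} [Ring A] [AddCommGroup M] [Module A M] [AddCommGroup M']
    [Module A M'] (f : M →+ M') (h : ∀ (a : A) (m : M), f (a • m) = a • f m) :
    M →ₗ[A] M' where
  toFun := f
  map_add' := f.map_add
  map_smul' a m := h a m

/-- An `A`-coring structure on an `A`-`A`-bimodule `C`: bilinear maps `Δ : C → C ⊗_A C` and
`ε : C → A` that are coassociative and counital. -/
class Coring (A : Type u) (C : Type v) [Ring A] [AddCommGroup C] [Module A C] [Module Aᵐᵒᵖ C]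
    [SMulCommClass A Aᵐᵒᵖ C] where
  comul : C →+ BTensor A C C
  comul_smul : ∀ (a : A) (c : C), comul (a • c) = a • comul c
  comul_op_smul : ∀ (a : A) (c : C), comul (op a • c) = op a • comul c
  counit : C →+ A
  counit_smul : ∀ (a : A) (c : C), counit (a • c) = a * counit c
  counit_op_smul : ∀ (a : A) (c : C), counit (op a • c) = counit c * a
  coassoc : ∀ c : C,
    assoc A (map A (rightLin comul comul_op_smul) LinearMap.id (comul c)) =
      map A LinearMap.id (leftLin comul comul_smul) (comul c)
  counit_left : ∀ c : C, evalLeft A (rightLin counit counit_op_smul) (comul c) = c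
  counit_right : ∀ c : C, evalRight A (leftLin counit counit_smul) (comul c) = c

/-- Locally projective modules (Zimmermann-Huisgen): for every finitely generated submodule
`F ⊆ M`, every surjection `f : N' → N` and every `g : M → N` there is `h : M → N'` with
`g = f ∘ h` on `F`. For right `A`-modules take `R = Aᵐᵒᵖ`. -/
def IsLocallyProjective (R : Type u) (M : Type v) [Ring R] [AddCommGroup M] [Module R M] : Prop :=
  ∀ F : Submodule R M, F.FG →
    ∀ (N' N : Type (max u v)) [AddCommGroup N'] [Module R N'] [AddCommGroup N] [Module R N]
      (f : N' →ₗ[R] N) (g : M →ₗ[R] N), Function.Surjective f →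
      ∃ h : M →ₗ[R] N', ∀ x ∈ F, g x = f (h x)

/-- Quasi-Frobenius rings: artinian and self-injective on both sides. -/
structure IsQuasiFrobenius (A : Type u) [Ring A] : Prop where
  artinian_left : IsArtinian A A
  artinian_right : IsArtinian Aᵐᵒᵖ A
  injective_left : Module.Injective A A
  injective_right : Module.Injective Aᵐᵒᵖ A

section Coring

variable (A : Type u) (C : Type v) [Ring A] [AddCommGroup C] [Module A C] [Module Aᵐᵒᵖ C]
  [SMulCommClass A Aᵐᵒᵖ C] [Coring A C]

/-- The comultiplication as a right linear map. -/
def comulR : C →ₗ[Aᵐᵒᵖ] BTensor A C C := rightLin Coring.comul (Coring.comul_op_smul (A := A))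

/-- The comultiplication as a left linear map. -/
def comulL : C →ₗ[A] BTensor A C C := leftLin Coring.comul (Coring.comul_smul (A := A))

/-- The counit as a right linear map. -/
def counitR : C →ₗ[Aᵐᵒᵖ] A := rightLin Coring.counit (Coring.counit_op_smul (A := A))

/-- The counit as a left linear map. -/
def counitL : C →ₗ[A] A := leftLin Coring.counit (Coring.counit_smul (A := A))

theorem coassoc' (c : C) : assoc A (map A (comulR A C) LinearMap.id (comulL A C c)) =
    map A LinearMap.id (comulL A C) (comulL A C c) := Coring.coassoc c

theorem comulR_eq (c : C) : comulR A C c = comulL A C c := rfl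

variable {A C}

section eval

variable {M N N' : Type*} [AddCommGroup M] [Module Aᵐᵒᵖ M] [AddCommGroup N] [Module A N]
  [AddCommGroup N'] [Module A N']

theorem evalLeft_map_right (f : M →ₗ[Aᵐᵒᵖ] A) (h : N →ₗ[A] N') (t : BTensor A M N) :
    evalLeft A f (map A LinearMap.id h t) = h (evalLeft A f t) :=
  hom_ext A (f := (evalLeft A f).comp (map A LinearMap.id h))
    (g := h.toAddMonoidHom.comp (evalLeft A f)) (fun m n => by simp) t

theorem evalLeft_map_left {M' : Type*} [AddCommGroup M'] [Module Aᵐᵒᵖ M']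
    (f : M' →ₗ[Aᵐᵒᵖ] A) (p : M →ₗ[Aᵐᵒᵖ] M') (t : BTensor A M N) :
    evalLeft A f (map A p LinearMap.id t) = evalLeft A (f ∘ₗ p) t :=
  hom_ext A (f := (evalLeft A f).comp (map A p LinearMap.id))
    (g := evalLeft A (f ∘ₗ p)) (fun m n => by simp) t

/-- `evalLeft` into a bimodule, as a right linear map. -/
def evalLeftR {D : Type*} [AddCommGroup D] [Module A D] [Module Aᵐᵒᵖ D] [SMulCommClass A Aᵐᵒᵖ D]
    (f : M →ₗ[Aᵐᵒᵖ] A) : BTensor A M D →ₗ[Aᵐᵒᵖ] D :=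
  rightLin (evalLeft A f) (fun a t =>
    evalLeft_map_right f (rsmul A (op a)) t)

/-- `evalRight` out of a bimodule, as a left linear map. -/
def evalRightL {D : Type*} [AddCommGroup D] [Module A D] [Module Aᵐᵒᵖ D] [SMulCommClass A Aᵐᵒᵖ D]
    (g : N →ₗ[A] A) : BTensor A D N →ₗ[A] D :=
  leftLin (evalRight A g) (fun a t =>
    hom_ext A (f := (evalRight A g).comp (map A (lsmul A a) LinearMap.id))
      (g := (lsmul (M := D) A a).toAddMonoidHom.comp (evalRight A g))
      (fun m n => by simp [lsmul, smul_comm]) t)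

theorem evalLeft_evalLeft_assoc {D : Type*} [AddCommGroup D] [Module A D] [Module Aᵐᵒᵖ D]
    [SMulCommClass A Aᵐᵒᵖ D] (f : D →ₗ[Aᵐᵒᵖ] A) (g : M →ₗ[Aᵐᵒᵖ] A)
    (t : BTensor A (BTensor A M D) N) :
    evalLeft A f (evalLeft A g (assoc A t)) = evalLeft A (f ∘ₗ evalLeftR g) t := by
  refine hom_ext A (f := (evalLeft A f).comp ((evalLeft A g).comp (assoc A)))
    (g := evalLeft A (f ∘ₗ evalLeftR g)) (fun u n => ?_) t
  induction u using BTensor.induction with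
  | zero => simp
  | tm m d =>
    simp only [AddMonoidHom.comp_apply, assoc_tmul, evalLeft_tmul, smul_tmul]
    rfl
  | add x y hx hy =>
    simp only [map_add, AddMonoidHom.add_apply, hx, hy]

end eval

variable (A C) in
/-- The right dual `C* = Hom_A(C, A)`, right `A`-linear maps, as an `A`-ring under
`(f * g)(c) = f(g(c₁) c₂)`. -/
def RightDual : Type (max u v) := C →ₗ[Aᵐᵒᵖ] A

namespace RightDual

instance : AddCommGroup (RightDual A C) := inferInstanceAs (AddCommGroup (C →ₗ[Aᵐᵒᵖ] A))

/-- `(a f)(c) = a f(c)`. -/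
instance : Module A (RightDual A C) := inferInstanceAs (Module A (C →ₗ[Aᵐᵒᵖ] A))

/-- The underlying right linear map. -/
def toLin (f : RightDual A C) : C →ₗ[Aᵐᵒᵖ] A := f

/-- An element of `C*` from a right linear map. -/
def ofLin (f : C →ₗ[Aᵐᵒᵖ] A) : RightDual A C := f

/-- The action `f · c = f(c₁) c₂` of `C*` on `C`. -/
def act (g : RightDual A C) : C →ₗ[Aᵐᵒᵖ] C := evalLeftR g.toLin ∘ₗ comulR A C

instance : Mul (RightDual A C) := ⟨fun f g => ofLin (f.toLin ∘ₗ g.act)⟩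
instance : One (RightDual A C) := ⟨ofLin (counitR A C)⟩

@[ext] theorem ext {f g : RightDual A C} (h : ∀ c, f.toLin c = g.toLin c) : f = g :=
  LinearMap.ext h

@[simp] theorem toLin_mul (f g : RightDual A C) : (f * g).toLin = f.toLin ∘ₗ g.act := rfl
@[simp] theorem toLin_one : (1 : RightDual A C).toLin = counitR A C := rfl
@[simp] theorem toLin_add (f g : RightDual A C) (c : C) :
    (f + g).toLin c = f.toLin c + g.toLin c := rfl
@[simp] theorem toLin_zero (c : C) : (0 : RightDual A C).toLin c = 0 := rfl
@[simp] theorem toLin_smul (a : A) (f : RightDual A C) (c : C) :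
    (a • f).toLin c = a * f.toLin c := rfl

theorem act_apply (g : RightDual A C) (c : C) : g.act c = evalLeft A g.toLin (comulL A C c) := rfl

theorem evalLeft_add {N : Type*} [AddCommGroup N] [Module A N] (f g : RightDual A C)
    (t : BTensor A C N) :
    evalLeft A (f + g).toLin t = evalLeft A f.toLin t + evalLeft A g.toLin t :=
  hom_ext A (f := evalLeft A (f + g).toLin) (g := evalLeft A f.toLin + evalLeft A g.toLin)
    (fun m n => by simp [add_smul]) t

theorem evalLeft_zero {N : Type*} [AddCommGroup N] [Module A N] (t : BTensor A C N) :
    evalLeft A (0 : RightDual A C).toLin t = 0 :=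
  hom_ext A (f := evalLeft A (0 : RightDual A C).toLin) (g := 0) (fun m n => by simp) t

theorem act_add (f g : RightDual A C) (c : C) : (f + g).act c = f.act c + g.act c :=
  evalLeft_add f g _

theorem act_zero (c : C) : (0 : RightDual A C).act c = 0 := evalLeft_zero _

theorem act_one (c : C) : (1 : RightDual A C).act c = c := Coring.counit_left c

theorem act_mul (f g : RightDual A C) (c : C) : (f * g).act c = f.act (g.act c) := by
  rw [act_apply f, act_apply g, ← evalLeft_map_right, ← coassoc', evalLeft_evalLeft_assoc,
    evalLeft_map_left]
  rfl

theorem toLin_act (f : RightDual A C) (c : C) : counitR A C (f.act c) = f.toLin c := by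
  have h := evalLeft_map_right (A := A) f.toLin (counitL A C) (comulL A C c)
  have h2 : ∀ t : BTensor A C C, evalLeft A f.toLin (map A LinearMap.id (counitL A C) t) =
      f.toLin (evalRight A (counitL A C) t) := fun t =>
    hom_ext A (f := (evalLeft A f.toLin).comp (map A LinearMap.id (counitL A C)))
      (g := f.toLin.toAddMonoidHom.comp (evalRight A (counitL A C))) (fun m n => by simp) t
  rw [h2] at h
  exact h.symm.trans (congrArg f.toLin (Coring.counit_right (A := A) c))

instance : Ring (RightDual A C) :=
  { (inferInstance : AddCommGroup (RightDual A C)) with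
    mul := (· * ·)
    one := 1
    mul_assoc := fun f g h => ext fun c => congrArg f.toLin (act_mul g h c).symm
    one_mul := fun f => ext fun c => toLin_act f c
    mul_one := fun f => ext fun c => congrArg f.toLin (act_one c)
    left_distrib := fun f g h =>
      ext fun c => (congrArg f.toLin (act_add g h c)).trans (map_add _ _ _)
    right_distrib := fun _ _ _ => rfl
    zero_mul := fun _ => rfl
    mul_zero := fun f => ext fun c => (congrArg f.toLin (act_zero c)).trans (map_zero _) }

instance : IsScalarTower A (RightDual A C) (RightDual A C) :=
  ⟨fun _ _ _ => rfl⟩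

variable (A C) in
/-- The unit `A → C*`, `a ↦ a ε`, of the `A`-ring `C*`. -/
def unitHom : A →+* RightDual A C where
  toFun a := a • 1
  map_one' := one_smul _ _
  map_zero' := zero_smul _ _
  map_add' a b := add_smul _ _ _
  map_mul' a b := by rw [smul_mul_assoc, one_mul, mul_smul]

/-- `(f * a)(c) = f(a c)`. -/
theorem toLin_mul_unitHom (f : RightDual A C) (a : A) (c : C) :
    (f * unitHom A C a).toLin c = f.toLin (a • c) := by
  have h : (unitHom A C a).act c = a • c := by
    have h2 : ∀ t : BTensor A C C, evalLeft A (unitHom A C a).toLin t =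
        a • evalLeft A (counitR A C) t := fun t =>
      hom_ext A (f := evalLeft A (unitHom A C a).toLin)
        (g := (lsmul (M := C) A a).toAddMonoidHom.comp (evalLeft A (counitR A C)))
        (fun m n => by simp [lsmul, unitHom, mul_smul]) t
    rw [act_apply, h2]
    exact congrArg (a • ·) (Coring.counit_left (A := A) c)
  exact congrArg f.toLin h

end RightDual

section LeftDual

/-- The right action `c · g = c₁ g(c₂)` of the left dual `*C = _AHom(C, A)` on `C`. -/
def leftDualAct (g : C →ₗ[A] A) : C →ₗ[A] C := evalRightL g ∘ₗ comulL A C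

/-- The multiplication `(f * g)(c) = g(c₁ f(c₂))` of the left dual `*C = _AHom(C, A)`. -/
def leftDualMul (f g : C →ₗ[A] A) : C →ₗ[A] A := g ∘ₗ leftDualAct f

/-- The element `c ↦ ε(c) a` of `*C`. -/
def leftDualUnit (a : A) : C →ₗ[A] A where
  toFun c := counitL A C c * a
  map_add' x y := by rw [map_add, add_mul]
  map_smul' b x := by simp [mul_assoc]

theorem leftDualAct_unit (a : A) (c : C) : leftDualAct (leftDualUnit a) c = op a • c := by
  have h2 : ∀ t : BTensor A C C, evalRight A (leftDualUnit (C := C) a) t =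
      op a • evalRight A (counitL A C) t := fun t =>
    hom_ext A (f := evalRight A (leftDualUnit (C := C) a))
      (g := (rsmul (N := C) A (op a)).toAddMonoidHom.comp (evalRight A (counitL A C)))
      (fun m n => by simp [rsmul, leftDualUnit, mul_smul]) t
  exact (h2 _).trans (congrArg (op a • ·) (Coring.counit_right (A := A) c))

theorem counitL_leftDualAct (f : C →ₗ[A] A) (c : C) : counitL A C (leftDualAct f c) = f c := by
  have h2 : ∀ t : BTensor A C C, counitL A C (evalRight A f t) =
      f (evalLeft A (counitR A C) t) := fun t =>
    hom_ext A (f := (counitL A C).toAddMonoidHom.comp (evalRight A f))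
      (g := f.toAddMonoidHom.comp (evalLeft A (counitR A C)))
      (fun m n => by
        simp only [AddMonoidHom.comp_apply, evalRight_tmul, evalLeft_tmul]
        exact (Coring.counit_op_smul (f n) m).trans (f.map_smul (counitR A C m) n).symm) t
  exact (h2 _).trans (congrArg f (Coring.counit_left (A := A) c))

theorem leftDualMul_unit (f : C →ₗ[A] A) (a : A) (c : C) :
    leftDualMul f (leftDualUnit a) c = f c * a :=
  congrArg (· * a) (counitL_leftDualAct f c)

variable (A C) in
/-- Morphisms `j : C → (*C)^I` of `A`-`*C`-bimodules. Here `*C` is an `A`-`*C`-bimodule through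
`(a f)(d) = f(d a)` and its multiplication, and `C` through `c · g = c₁ g(c₂)`. -/
structure FrobeniusMorphism (I : Type w) where
  toFun : C →+ (I → (C →ₗ[A] A))
  map_smul : ∀ (a : A) (c : C) (l : I) (d : C), toFun (a • c) l d = toFun c l (op a • d)
  map_act : ∀ (c : C) (g : C →ₗ[A] A) (l : I),
    toFun (leftDualAct g c) l = leftDualMul (toFun c l) g

/-- The map `j̃ : C^(I) → C*` obtained from `j : C → (*C)^I` by switching arguments:
`j̃(z)(d) = ∑ l, j(d)_l (z_l)`. -/
def FrobeniusMorphism.tilde {I : Type w} (j : FrobeniusMorphism A C I) (z : I →₀ C) :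
    RightDual A C :=
  RightDual.ofLin
    { toFun := fun d => z.sum fun l c => j.toFun d l c
      map_add' := fun x y => by simp [Finsupp.sum_add]
      map_smul' := fun a x => by
        have h : ∀ l c, j.toFun (a • x) l c = a • j.toFun x l c := fun l c => by
          have := leftDualAct_unit (A := A) (C := C) a.unop x
          rw [op_unop] at this
          rw [← this, j.map_act, leftDualMul_unit]
          rfl
        simp [h, Finsupp.smul_sum] }

end LeftDual

/-- Left `B`-locally quasi-Frobenius corings, for a ring morphism `φ : B → A`: `C` is locally
projective as a left `A`-module and, for some `A`-`*C`-bilinear `j : C → (*C)^I`, the image under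
`j̃` of the `B`-centralizer of `C^(I)` is dense in the `B`-centralizer `(C*)^B` of `C*`
for the finite topology. -/
def IsLeftLocallyQuasiFrobenius {B : Type u'} [Ring B] (φ : B →+* A) (C : Type v)
    [AddCommGroup C] [Module A C] [Module Aᵐᵒᵖ C] [SMulCommClass A Aᵐᵒᵖ C] [Coring A C] : Prop :=
  IsLocallyProjective A C ∧
    ∃ (I : Type w') (j : FrobeniusMorphism A C I),
      ∀ (S : Finset C) (f : RightDual A C), (∀ (b : B) (c : C), f.toLin (φ b • c) = φ b * f.toLin c) →
        ∃ z : I →₀ C, (∀ (l : I) (b : B), φ b • z l = op (φ b) • z l) ∧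
          ∀ c ∈ S, (j.tilde z).toLin c = f.toLin c

section Comodules

variable (A C) in
/-- Left comodules over the coring `C`. -/
structure LeftComodule where
  carrier : Type w
  [addCommGroup : AddCommGroup carrier]
  [module : Module A carrier]
  coact : carrier →ₗ[A] BTensor A C carrier
  coassoc : ∀ m : carrier, assoc A (map A (comulR A C) LinearMap.id (coact m)) =
    map A LinearMap.id coact (coact m)
  counit : ∀ m : carrier, evalLeft A (counitR A C) (coact m) = m

attribute [instance] LeftComodule.addCommGroup LeftComodule.module

namespace LeftComodule

/-- Colinear maps. -/
@[ext] structure Hom (M N : LeftComodule.{u, v, w} A C) where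
  toLin : M.carrier →ₗ[A] N.carrier
  colinear : ∀ m : M.carrier, map A LinearMap.id toLin (M.coact m) = N.coact (toLin m)

theorem map_id_comp {P N N' N'' : Type*} [AddCommGroup P] [Module Aᵐᵒᵖ P] [AddCommGroup N]
    [Module A N] [AddCommGroup N'] [Module A N'] [AddCommGroup N''] [Module A N'']
    (g : N' →ₗ[A] N'') (f : N →ₗ[A] N') (t : BTensor A P N) :
    map A LinearMap.id (g ∘ₗ f) t = map A LinearMap.id g (map A LinearMap.id f t) :=
  hom_ext A (f := map A LinearMap.id (g ∘ₗ f))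
    (g := (map A LinearMap.id g).comp (map A LinearMap.id f)) (fun m n => by simp) t

theorem map_id_id {P N : Type*} [AddCommGroup P] [Module Aᵐᵒᵖ P] [AddCommGroup N]
    [Module A N] (t : BTensor A P N) :
    map A LinearMap.id LinearMap.id t = t :=
  hom_ext A (f := map A LinearMap.id LinearMap.id) (g := AddMonoidHom.id _)
    (fun m n => by simp) t

instance : Category (LeftComodule.{u, v, w} A C) where
  Hom := Hom
  id M := ⟨LinearMap.id, fun m => map_id_id _⟩
  comp f g := ⟨g.toLin ∘ₗ f.toLin, fun m => by
    rw [map_id_comp, f.colinear, g.colinear]; rfl⟩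

/-- Finitely generated comodules: there is a finite set `S` of elements of `M` such that every
colinear map into `M` whose image contains `S` is surjective. -/
def IsFinitelyGenerated (M : LeftComodule.{u, v, w} A C) : Prop :=
  ∃ S : Finset M.carrier, ∀ (N : LeftComodule.{u, v, w} A C) (g : N ⟶ M),
    (∀ s ∈ S, ∃ n : N.carrier, g.toLin n = s) → Function.Surjective g.toLin

end LeftComodule

/-- `p : P → M` is a projective cover: `P` is projective and `p` is a superfluous epimorphism. -/
structure IsProjectiveCover {𝒜 : Type u'} [Category.{v} 𝒜] {P M : 𝒜} (p : P ⟶ M) : Prop where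
  projective : Projective P
  epi : Epi p
  superfluous : ∀ {N : 𝒜} (g : N ⟶ P), Epi (g ≫ p) → Epi g

variable (A C) in
/-- Left semiperfect corings: every finitely generated left comodule has a projective cover
in the category of left comodules. -/
def IsLeftSemiperfect : Prop :=
  ∀ M : LeftComodule.{u, v, max u v} A C, M.IsFinitelyGenerated →
    ∃ (P : LeftComodule.{u, v, max u v} A C) (p : P ⟶ M), IsProjectiveCover p

end Comodules

section Rational

/-- A finite local dual basis of a locally projective right module. -/
theorem exists_dualBasis (hC : IsLocallyProjective Aᵐᵒᵖ C) (S : Finset C) :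
    ∃ (K : Finset C) (f : C → RightDual A C),
      ∀ c ∈ S, ∑ e ∈ K, op ((f e).toLin c) • e = c := by
  classical
  let s : (C →₀ Aᵐᵒᵖ) →ₗ[Aᵐᵒᵖ] C := Finsupp.linearCombination Aᵐᵒᵖ id
  let d : C ≃ₗ[Aᵐᵒᵖ] ULift.{u} C := ULift.moduleEquiv.symm
  have hs : Function.Surjective (d.toLinearMap ∘ₗ s) := by
    intro y
    refine ⟨Finsupp.single (d.symm y) 1, ?_⟩
    simp [s]
  obtain ⟨h, hh⟩ := hC (Submodule.span Aᵐᵒᵖ (S : Set C)) ⟨S, rfl⟩ (C →₀ Aᵐᵒᵖ) (ULift.{u} C)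
    (d.toLinearMap ∘ₗ s) d.toLinearMap hs
  refine ⟨S.biUnion fun c => (h c).support, fun e => RightDual.ofLin
    { toFun := fun c => (h c e).unop
      map_add' := fun x y => by simp
      map_smul' := fun a x => by simp }, fun c hc => ?_⟩
  have h1 : c = s (h c) := d.injective (hh c (Submodule.subset_span hc))
  conv_rhs => rw [h1]
  change ∑ e ∈ _, op ((h c e).unop) • e = _
  simp only [op_unop, s, Finsupp.linearCombination_apply, id]
  exact (Finsupp.sum_of_support_subset (h c)
    (Finset.subset_biUnion_of_mem (fun c => (h c).support) hc) (fun i a => a • i)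
    (fun _ _ => zero_smul _ _)).symm

theorem exists_repr {N : Type*} [AddCommGroup N] [Module A N] (hC : IsLocallyProjective Aᵐᵒᵖ C)
    (t : BTensor A C N) :
    ∃ (K : Finset C) (f : C → RightDual A C),
      t = ∑ e ∈ K, tmul A e (evalLeft A (f e).toLin t) := by
  classical
  have key : ∃ S : Finset C, ∀ (K : Finset C) (f : C → RightDual A C),
      (∀ c ∈ S, ∑ e ∈ K, op ((f e).toLin c) • e = c) →
        t = ∑ e ∈ K, tmul A e (evalLeft A (f e).toLin t) := by
    induction t using BTensor.induction with
    | zero => exact ⟨∅, fun K f _ => by simp⟩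
    | tm c n =>
      refine ⟨{c}, fun K f h => ?_⟩
      have h1 := h c (Finset.mem_singleton_self c)
      conv_lhs => rw [← h1]
      rw [map_sum, AddMonoidHom.finsetSum_apply]
      exact Finset.sum_congr rfl fun e _ => by rw [evalLeft_tmul, tmul_balanced]
    | add x y hx hy =>
      obtain ⟨S, hS⟩ := hx
      obtain ⟨S', hS'⟩ := hy
      refine ⟨S ∪ S', fun K f h => ?_⟩
      have h1 := hS K f fun c hc => h c (Finset.mem_union_left _ hc)
      have h2 := hS' K f fun c hc => h c (Finset.mem_union_right _ hc)
      simp only [map_add, Finset.sum_add_distrib]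
      rw [← h1, ← h2]
  obtain ⟨S, hS⟩ := key
  obtain ⟨K, f, h⟩ := exists_dualBasis hC S
  exact ⟨K, f, hS K f h⟩

/-- For `C` locally projective as a right module, the maps `evalLeft f`, `f ∈ C*`, separate
the elements of `C ⊗_A N`. -/
theorem evalLeft_separating {N : Type*} [AddCommGroup N] [Module A N]
    (hC : IsLocallyProjective Aᵐᵒᵖ C) {t t' : BTensor A C N}
    (h : ∀ f : RightDual A C, evalLeft A f.toLin t = evalLeft A f.toLin t') : t = t' := by
  rw [← sub_eq_zero]
  obtain ⟨K, f, hK⟩ := exists_repr hC (t - t')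
  rw [hK]
  exact Finset.sum_eq_zero fun e _ => by rw [map_sub, h, sub_self, map_zero]

variable {N : Type w} [AddCommGroup N] [Module A N] [Module (RightDual A C) N]
  [IsScalarTower A (RightDual A C) N]

variable (A C) in
/-- Rational elements of a left `C*`-module: there is `∑ cᵢ ⊗ nᵢ` with
`f · n = ∑ f(cᵢ) nᵢ` for all `f ∈ C*`. -/
def IsRational (n : N) : Prop :=
  ∃ t : BTensor A C N, ∀ f : RightDual A C, f • n = evalLeft A f.toLin t

theorem IsRational.smul {n : N} (h : IsRational A C n) (g : RightDual A C) :
    IsRational A C (g • n) := by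
  obtain ⟨t, ht⟩ := h
  refine ⟨map A g.act LinearMap.id t, fun f => ?_⟩
  rw [← mul_smul, ht, evalLeft_map_left]
  rfl

variable (A C N) in
/-- The rational part of a left `C*`-module, a `C*`-submodule. -/
def ratSubmodule : Submodule (RightDual A C) N where
  carrier := {n | IsRational A C n}
  zero_mem' := ⟨0, fun f => by simp⟩
  add_mem' := by
    rintro x y ⟨t, ht⟩ ⟨s, hs⟩
    exact ⟨t + s, fun f => by rw [smul_add, ht, hs, map_add]⟩
  smul_mem' g _ h := IsRational.smul h g

theorem isRational_ratSubmodule (hC : IsLocallyProjective Aᵐᵒᵖ C) (n : ratSubmodule A C N) :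
    IsRational A C n := by
  obtain ⟨t, ht⟩ := n.2
  obtain ⟨K, f, hK⟩ := exists_repr hC t
  refine ⟨∑ e ∈ K, tmul A e (f e • n), fun g => Subtype.ext ?_⟩
  rw [Submodule.coe_smul, ht]
  conv_lhs => rw [hK]
  simp only [map_sum, evalLeft_tmul]
  rw [Submodule.coe_sum]
  exact Finset.sum_congr rfl fun e _ => congrArg (g.toLin e • ·) (ht (f e)).symm

/-- The element of `C ⊗_A N` that witnesses rationality. -/
def ratCoact (hN : ∀ n : N, IsRational A C n) (n : N) : BTensor A C N := (hN n).choose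

theorem evalLeft_ratCoact (hN : ∀ n : N, IsRational A C n) (n : N) (f : RightDual A C) :
    evalLeft A f.toLin (ratCoact hN n) = f • n := ((hN n).choose_spec f).symm

/-- The coaction on a rational `C*`-module `N`: `ρ(n) = ∑ cᵢ ⊗ nᵢ` if and only if
`f · n = ∑ f(cᵢ) nᵢ` for all `f ∈ C*`. -/
def ratCoactL (hC : IsLocallyProjective Aᵐᵒᵖ C) (hN : ∀ n : N, IsRational A C n) :
    N →ₗ[A] BTensor A C N where
  toFun := ratCoact hN
  map_add' x y := evalLeft_separating hC fun f => by
    rw [map_add]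
    simp only [evalLeft_ratCoact, smul_add]
  map_smul' a x := evalLeft_separating hC fun f => by
    have h : evalLeft A f.toLin (a • ratCoact hN x) =
        evalLeft A (f * RightDual.unitHom A C a).toLin (ratCoact hN x) := by
      have h1 : (f * RightDual.unitHom A C a).toLin = f.toLin ∘ₗ lsmul A a :=
        LinearMap.ext fun c => RightDual.toLin_mul_unitHom f a c
      rw [h1]
      exact evalLeft_map_left f.toLin (lsmul A a) _
    rw [RingHom.id_apply, h, evalLeft_ratCoact, evalLeft_ratCoact, mul_smul]
    congr 1
    change a • x = (a • (1 : RightDual A C)) • x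
    rw [smul_assoc, one_smul]

theorem evalLeft_ratCoactL (hC : IsLocallyProjective Aᵐᵒᵖ C) (hN : ∀ n : N, IsRational A C n)
    (n : N) (f : RightDual A C) :
    evalLeft A f.toLin (ratCoactL hC hN n) = f • n := evalLeft_ratCoact hN n f

variable (N) in
/-- A rational left `C*`-module as a left `C`-comodule. -/
def ratComodule (hC : IsLocallyProjective Aᵐᵒᵖ C) (hN : ∀ n : N, IsRational A C n) :
    LeftComodule.{u, v, w} A C where
  carrier := N
  coact := ratCoactL hC hN
  coassoc n := evalLeft_separating hC fun f => evalLeft_separating hC fun g => by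
    rw [evalLeft_evalLeft_assoc, evalLeft_map_left, evalLeft_map_right, evalLeft_ratCoactL,
      evalLeft_ratCoactL, ← mul_smul]
    exact evalLeft_ratCoactL hC hN n (g * f)
  counit n := (evalLeft_ratCoactL hC hN n 1).trans (one_smul _ _)

theorem colinear_of_linear {N' : Type w} [AddCommGroup N'] [Module A N']
    [Module (RightDual A C) N'] [IsScalarTower A (RightDual A C) N']
    (hC : IsLocallyProjective Aᵐᵒᵖ C) (hN : ∀ n : N, IsRational A C n)
    (hN' : ∀ n : N', IsRational A C n) (φ : N →ₗ[A] N')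
    (hφ : ∀ (f : RightDual A C) (n : N), φ (f • n) = f • φ n) (n : N) :
    map A LinearMap.id φ (ratCoactL hC hN n) = ratCoactL hC hN' (φ n) :=
  evalLeft_separating hC fun f => by
    rw [evalLeft_map_right, evalLeft_ratCoactL, evalLeft_ratCoactL, hφ]

/-- The restriction of a `C*`-linear map to the rational parts. -/
def ratMap {N' : Type w} [AddCommGroup N'] [Module A N']
    [Module (RightDual A C) N'] [IsScalarTower A (RightDual A C) N']
    (φ : N →ₗ[RightDual A C] N') :
    ratSubmodule A C N →ₗ[RightDual A C] ratSubmodule A C N' :=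
  φ.restrict (by
    rintro n ⟨t, ht⟩
    refine ⟨map A LinearMap.id (φ.restrictScalars A) t, fun f => ?_⟩
    rw [evalLeft_map_right, ← ht, ← map_smul]
    rfl)

variable (A C) in
/-- A left `C*`-module is a left `A`-module through `A → C*`. -/
abbrev restrictModule (M : Type w) [AddCommGroup M] [Module (RightDual A C) M] : Module A M :=
  Module.compHom M (RightDual.unitHom A C)

theorem restrictModule_isScalarTower (M : Type w) [AddCommGroup M] [Module (RightDual A C) M] :
    letI := restrictModule A C M
    IsScalarTower A (RightDual A C) M :=
  letI := restrictModule A C M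
  ⟨fun a f m => by
    change (a • f) • m = (a • (1 : RightDual A C)) • f • m
    rw [← mul_smul, smul_mul_assoc, one_mul]⟩

variable (A C) in
/-- The left rational functor: a left `C*`-module `M` is sent to its rational part
`{m | ∃ ∑ cᵢ ⊗ mᵢ, ∀ f, f · m = ∑ f(cᵢ) mᵢ}` with the coaction `ρ(m) = ∑ cᵢ ⊗ mᵢ`. -/
def ratFunctor (hC : IsLocallyProjective Aᵐᵒᵖ C) :
    ModuleCat.{w} (RightDual A C) ⥤ LeftComodule.{u, v, w} A C where
  obj M :=
    letI := restrictModule A C M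
    haveI := restrictModule_isScalarTower (A := A) (C := C) M
    ratComodule (ratSubmodule A C M) hC (isRational_ratSubmodule hC)
  map {M M'} φ :=
    letI := restrictModule A C M
    haveI := restrictModule_isScalarTower (A := A) (C := C) M
    letI := restrictModule A C M'
    haveI := restrictModule_isScalarTower (A := A) (C := C) M'
    ⟨(ratMap φ.hom).restrictScalars A, colinear_of_linear hC (isRational_ratSubmodule hC)
      (isRational_ratSubmodule hC) _ fun f n => map_smul (ratMap φ.hom) f n⟩
  map_id _ := rfl
  map_comp _ _ := rfl

end Rational

end Coring
end CoringTheory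

end

/-!
The proof rests on the exchange formula `c₁ j(d)(c₂) = j(d₁)(c) d₂`
(`FrobeniusMorphism.leftDualAct_toFun`). A left linear form `g` turns it into the right
`*C`-linearity of `j`, evaluated at `c`, and left linear forms separate the points of the locally
projective left module `C`.

Approximating `ε`, which centralizes `B`, by `j̃(z)` on the left factors of `Δ(d)` and applying the
formula gives `d = ε(d₁) d₂ = z₁ j(d)(z₂)`, a finite dual basis for the right module `C`
(`isLocallyProjective_right`). The formula also says that `j̃` is left `C*`-linear, so its image
consists of rational elements of `C*`, and density provides rational elements of `C*` that act as
the identity on any given finite set of rational elements of a module (`HasRationalLocalUnits`).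

Exactness: left comodules are a full subcategory of the left `C*`-modules, so it suffices to see
that the rational part of a surjection `N → N'` is surjective. If `n` is rational, `e` is a rational
element of `C*` with `e n = n` and `m` lifts `n`, then `e m` is a rational lift of `n`.

Semiperfectness: a finitely generated rational module is finitely generated over the artinian ring
`A`, so it has finite length. For a rational `t ∈ C*` this applies to the left ideal `C* t`, and
Fitting's lemma for `y ↦ y t` yields a rational idempotent `g` fixing every element that `t` fixes
(`exists_idempotent_mem_span_singleton`). Hence a finitely generated comodule `M` is a quotient of a
finite power `P` of the rational projective module `C* g`. Since `P` has finite length, among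
the endomorphisms of `P` over `M` there is one of minimal range; this range is a retract of `P`
and the restriction of `P → M` to it is superfluous (`exists_projective_superfluous`).
-/

/-! ### Idempotents and minimal projective covers for modules of finite length -/

section RingTheory

variable {R : Type*} [Ring R]

/-- Fitting's lemma for the endomorphism `y ↦ y * t` of the left ideal `R t`: if this ideal has
finite length, it contains an idempotent `g` that fixes a power of `t`. Every element of a module
fixed by `t` is then fixed by `g`. -/
theorem exists_idempotent_mem_span_singleton (t : R)
    [IsArtinian R (Submodule.span R {t})] [IsNoetherian R (Submodule.span R {t})] :
    ∃ g ∈ Submodule.span R {t}, g * g = g ∧ ∃ n : ℕ, g * t ^ n = t ^ n := by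
  set L := Submodule.span R {t}
  have htL : t ∈ L := Submodule.mem_span_singleton_self t
  let F : Module.End R L := (LinearMap.toSpanSingleton R R t).restrict (p := L) (q := L)
    (fun x _ => by simpa using L.smul_mem x htL)
  have hF : ∀ x : L, ((F x : L) : R) = x * t := fun x => by
    simp [F, LinearMap.restrict_apply]
  have hFn : ∀ (n : ℕ) (x : L), (((F ^ n) x : L) : R) = x * t ^ n := by
    intro n
    induction n with
    | zero => intro x; simp
    | succ n ih => intro x; rw [pow_succ', Module.End.mul_apply, hF, ih, mul_assoc, pow_succ]
  obtain ⟨n, hn, hn0⟩ := ((LinearMap.eventually_isCompl_ker_pow_range_pow F).and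
    (Filter.eventually_ge_atTop 1)).exists
  have hw : t ^ n ∈ L := by
    obtain ⟨m, rfl⟩ := Nat.exists_eq_add_of_le' hn0
    rw [pow_succ]
    exact L.smul_mem _ htL
  have decomp : ∀ x : L, ∃ k y : L, (k : R) * t ^ n = 0 ∧ (x : R) = k + y * t ^ n := by
    intro x
    have hx : x ∈ (F ^ n).ker ⊔ (F ^ n).range := by rw [hn.sup_eq_top]; trivial
    obtain ⟨k, hk, _, ⟨y, rfl⟩, rfl⟩ := Submodule.mem_sup.1 hx
    refine ⟨k, y, ?_, ?_⟩
    · rw [← hFn, LinearMap.mem_ker.1 hk]; rfl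
    · rw [Submodule.coe_add, hFn]
  have inj : ∀ y : L, (y : R) * t ^ n * t ^ n = 0 → (y : R) * t ^ n = 0 := by
    intro y hy
    have h1 : (F ^ n) y ∈ (F ^ n).ker ⊓ (F ^ n).range :=
      ⟨LinearMap.mem_ker.2 (Subtype.ext (by rw [hFn, hFn, hy]; rfl)), ⟨y, rfl⟩⟩
    rw [hn.inf_eq_bot] at h1
    rw [← hFn, (Submodule.mem_bot R).1 h1]; rfl
  -- `t ^ n = k + y * t ^ n` gives `y * t ^ (2 * n) = t ^ (2 * n)`; `g` is the component of `y` in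
  -- the range of `F ^ n`, on which right multiplication by `t ^ n` is injective.
  obtain ⟨k, y, hk, hky⟩ := decomp ⟨t ^ n, hw⟩
  obtain ⟨k', z, hk', hz⟩ := decomp y
  simp only at hky
  have hg : (z : R) * t ^ n * (t ^ n * t ^ n) = t ^ n * t ^ n := by
    have h1 : t ^ n * t ^ n = y * t ^ n * t ^ n := by
      simpa only [add_mul, hk, zero_add] using congrArg (· * t ^ n) hky
    rw [hz, add_mul, hk', zero_add] at h1
    rw [← mul_assoc, ← h1]
  have hgL : (z : R) * t ^ n ∈ L := L.smul_mem _ hw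
  refine ⟨z * t ^ n, hgL, ?_, n + n, by rw [pow_add, hg]⟩
  generalize hw' : t ^ n = w at *
  let e : L := ⟨z * w * z - z, L.sub_mem (L.smul_mem _ z.2) z.2⟩
  let e' : L := ⟨(z * w * z - z) * w, L.smul_mem _ hw⟩
  have h2 : ((z : R) * w * z - z) * w * w * w = 0 := by
    simp only [sub_mul, mul_assoc] at hg ⊢
    rw [hg, hg, sub_self]
  have h3 : ((z : R) * w * z - z) * w = 0 := inj e (inj e' h2)
  simpa [sub_mul, sub_eq_zero, mul_assoc] using h3

/-- A surjection `p` from a projective module of finite length restricts to a superfluous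
surjection on some projective submodule `P'`. -/
theorem exists_projective_superfluous {P M : Type*} [AddCommGroup P] [Module R P]
    [AddCommGroup M] [Module R M] [Module.Projective R P] [IsArtinian R P] [IsNoetherian R P]
    (p : P →ₗ[R] M) (hp : Function.Surjective p) :
    ∃ P' : Submodule R P, Module.Projective R P' ∧ Function.Surjective (p ∘ₗ P'.subtype) ∧
      ∀ Q : Submodule R P, Q ≤ P' → Q.map p = ⊤ → Q = P' := by
  obtain ⟨_, ⟨h, hph, rfl⟩, hmin⟩ := WellFounded.has_min
    (wellFounded_lt (α := Submodule R P))
    {Q | ∃ h : P →ₗ[R] P, p ∘ₗ h = p ∧ LinearMap.range h = Q} ⟨_, LinearMap.id, by simp, rfl⟩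
  have hmin' : ∀ k : P →ₗ[R] P, p ∘ₗ k = p → k.range ≤ h.range → k.range = h.range :=
    fun k hk hle => hle.eq_of_not_lt (hmin _ ⟨k, hk, rfl⟩)
  -- By minimality `h` maps its range onto itself, hence bijectively, and the range is a retract.
  let h' : h.range →ₗ[R] h.range := h.rangeRestrict ∘ₗ h.range.subtype
  have hsurj : Function.Surjective h' := by
    rintro ⟨x, hx⟩
    have h2 : (h ∘ₗ h).range = h.range :=
      hmin' _ (by rw [← LinearMap.comp_assoc, hph, hph]) (LinearMap.range_comp_le_range h h)
    rw [← h2] at hx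
    obtain ⟨y, rfl⟩ := hx
    exact ⟨⟨h y, y, rfl⟩, rfl⟩
  let E := LinearEquiv.ofBijective h'
    ⟨IsNoetherian.injective_of_surjective_endomorphism h' hsurj, hsurj⟩
  refine ⟨h.range, Module.Projective.of_split h.range.subtype
    (E.symm.toLinearMap ∘ₗ h.rangeRestrict) ?_, ?_, ?_⟩
  · ext x
    have : h.rangeRestrict (x : P) = E x := rfl
    simp [this]
  · intro m
    obtain ⟨x, rfl⟩ := hp m
    exact ⟨⟨h x, x, rfl⟩, LinearMap.congr_fun hph x⟩
  · intro Q hQ hQp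
    have hs : Function.Surjective (p ∘ₗ Q.subtype) := by
      rw [← LinearMap.range_eq_top, LinearMap.range_comp, Submodule.range_subtype, hQp]
    obtain ⟨k, hk⟩ := Module.projective_lifting_property (p ∘ₗ Q.subtype) p hs
    have hle : (Q.subtype ∘ₗ k).range ≤ Q := by
      rintro _ ⟨x, rfl⟩
      exact (k x).2
    exact hQ.antisymm ((hmin' (Q.subtype ∘ₗ k) (by rw [← LinearMap.comp_assoc, hk])
      (hle.trans hQ)).ge.trans hle)

end RingTheory

noncomputable section

namespace CoringTheory

open BTensor

/-! ### Local projectivity and the separation of points by the dual -/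

/-- Every element of a locally projective left module is determined by its values under the
linear forms. -/
theorem IsLocallyProjective.dual_separating {A : Type u} {C : Type v} [Ring A] [AddCommGroup C]
    [Module A C] (hC : IsLocallyProjective A C) {x y : C}
    (h : ∀ g : C →ₗ[A] A, g x = g y) : x = y := by
  let d : C ≃ₗ[A] ULift.{u} C := ULift.moduleEquiv.symm
  let s : (C →₀ A) →ₗ[A] ULift.{u} C := d.toLinearMap ∘ₗ Finsupp.linearCombination A id
  have hs : Function.Surjective s := fun y =>
    ⟨Finsupp.single (d.symm y) 1, by simp [s]⟩
  obtain ⟨k, hk⟩ := hC (Submodule.span A {x - y}) ⟨{x - y}, by simp⟩ _ _ s d.toLinearMap hs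
  have h0 : k (x - y) = 0 := by
    ext e
    have := h (Finsupp.lapply e ∘ₗ k)
    simpa [sub_eq_zero] using this
  have h1 := hk (x - y) (Submodule.mem_span_singleton_self _)
  rw [h0, map_zero] at h1
  exact sub_eq_zero.1 (d.injective (h1.trans (map_zero d).symm))

/-- Finite local dual bases make a right module locally projective. -/
theorem isLocallyProjective_of_dualBasis {A : Type u} {C : Type v} [Ring A] [AddCommGroup C]
    [Module Aᵐᵒᵖ C]
    (h : ∀ S : Finset C, ∃ l : List (C × (C →ₗ[Aᵐᵒᵖ] A)),
      ∀ c ∈ S, (l.map fun p => op (p.2 c) • p.1).sum = c) :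
    IsLocallyProjective Aᵐᵒᵖ C := by
  rintro _ ⟨S, rfl⟩ N' N _ _ _ _ f g hf
  obtain ⟨l, hl⟩ := h S
  choose s hs using hf
  let o : A ≃ₗ[Aᵐᵒᵖ] Aᵐᵒᵖ :=
    { opAddEquiv with map_smul' := fun a x => by simp }
  let k : C →ₗ[Aᵐᵒᵖ] N' :=
    (l.map fun p => (o.toLinearMap ∘ₗ p.2).smulRight (s (g p.1))).sum
  have hk : ∀ c, k c = (l.map fun p => op (p.2 c) • s (g p.1)).sum := by
    intro c
    change (List.sum _ : C →ₗ[Aᵐᵒᵖ] N') c = _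
    clear hl k
    induction l with
    | nil => rfl
    | cons p l ih => rw [List.map_cons, List.sum_cons, LinearMap.add_apply, ih, List.map_cons,
        List.sum_cons]; rfl
  refine ⟨k, fun x hx => ?_⟩
  refine LinearMap.eqOn_span (f := g) (g := f ∘ₗ k) (fun c hc => ?_) hx
  rw [LinearMap.comp_apply, hk, map_list_sum, List.map_map]
  conv_lhs => rw [← hl c hc, map_list_sum, List.map_map]
  congr 1
  exact List.map_congr_left fun p _ => by simp [hs]

section Coring

variable {A : Type u} {C : Type v} [Ring A] [AddCommGroup C] [Module A C] [Module Aᵐᵒᵖ C]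
  [SMulCommClass A Aᵐᵒᵖ C] [Coring A C]

/-! ### Evaluation of balanced tensors -/

namespace BTensor

variable {N : Type*} [AddCommGroup N] [Module A N]

/-- Evaluating a tensor at `f` involves the values of `f` at finitely many elements only. -/
theorem exists_finset_evalLeft_congr {M : Type*} [AddCommGroup M] [Module Aᵐᵒᵖ M]
    (t : BTensor A M N) :
    ∃ S : Finset M, ∀ f g : M →ₗ[Aᵐᵒᵖ] A, (∀ c ∈ S, f c = g c) →
      evalLeft A f t = evalLeft A g t := by
  classical
  induction t using BTensor.induction with
  | zero => exact ⟨∅, fun f g _ => by simp⟩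
  | tm c n => exact ⟨{c}, fun f g h => by simp [h c (Finset.mem_singleton_self c)]⟩
  | add x y hx hy =>
    obtain ⟨S, hS⟩ := hx
    obtain ⟨S', hS'⟩ := hy
    refine ⟨S ∪ S', fun f g h => ?_⟩
    rw [map_add, map_add, hS f g fun c hc => h c (Finset.mem_union_left _ hc),
      hS' f g fun c hc => h c (Finset.mem_union_right _ hc)]

theorem exists_finset_evalLeft_mem_span {M : Type*} [AddCommGroup M] [Module Aᵐᵒᵖ M]
    (t : BTensor A M N) :
    ∃ S : Finset N, ∀ f : M →ₗ[Aᵐᵒᵖ] A, evalLeft A f t ∈ Submodule.span A (S : Set N) := by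
  classical
  induction t using BTensor.induction with
  | zero => exact ⟨∅, fun f => by simp⟩
  | tm c n => exact ⟨{n}, fun f => Submodule.smul_mem _ _ (Submodule.subset_span (by simp))⟩
  | add x y hx hy =>
    obtain ⟨S, hS⟩ := hx
    obtain ⟨S', hS'⟩ := hy
    refine ⟨S ∪ S', fun f => ?_⟩
    rw [map_add]
    exact add_mem (Submodule.span_mono (by simp) (hS f)) (Submodule.span_mono (by simp) (hS' f))

theorem exists_list_evalRight {M : Type*} [AddCommGroup M] [Module Aᵐᵒᵖ M] (t : BTensor A M N) :
    ∃ l : List (M × N), ∀ g : N →ₗ[A] A,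
      evalRight A g t = (l.map fun p => op (g p.2) • p.1).sum := by
  induction t using BTensor.induction with
  | zero => exact ⟨[], fun g => by simp⟩
  | tm c n => exact ⟨[(c, n)], fun g => by simp⟩
  | add x y hx hy =>
    obtain ⟨l, hl⟩ := hx
    obtain ⟨l', hl'⟩ := hy
    exact ⟨l ++ l', fun g => by rw [map_add, hl, hl', List.map_append, List.sum_append]⟩

/-- `f(m g(n)) = g(f(m) n)`. -/
theorem apply_evalRight {M : Type*} [AddCommGroup M] [Module Aᵐᵒᵖ M]
    (f : M →ₗ[Aᵐᵒᵖ] A) (g : N →ₗ[A] A) (t : BTensor A M N) :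
    f (evalRight A g t) = g (evalLeft A f t) :=
  hom_ext A (f := f.toAddMonoidHom.comp (evalRight A g))
    (g := g.toAddMonoidHom.comp (evalLeft A f)) (fun m n => by simp) t

end BTensor

/-! ### The map `j̃` of a Frobenius morphism -/

namespace FrobeniusMorphism

variable {I : Type w} (j : FrobeniusMorphism A C I)

theorem tilde_apply (z : I →₀ C) (d : C) :
    (j.tilde z).toLin d = z.sum fun l c => j.toFun d l c := rfl

theorem tilde_single_apply (l : I) (c d : C) :
    (j.tilde (Finsupp.single l c)).toLin d = j.toFun d l c := by
  simp [tilde_apply]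

theorem tilde_add (z z' : I →₀ C) : j.tilde (z + z') = j.tilde z + j.tilde z' :=
  RightDual.ext fun d => by
    rw [RightDual.toLin_add, tilde_apply, tilde_apply, tilde_apply]
    exact Finsupp.sum_add_index' (fun l => map_zero _) (fun l => map_add _)

/-- The component of `j̃` at `l`, as a left `A`-linear map `C → C*`. -/
def tildeSingle (l : I) : C →ₗ[A] RightDual A C where
  toFun c := j.tilde (Finsupp.single l c)
  map_add' x y := by rw [Finsupp.single_add, tilde_add]
  map_smul' a x := RightDual.ext fun d => by
    rw [RingHom.id_apply, RightDual.toLin_smul, tilde_single_apply, tilde_single_apply,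
      _root_.map_smul, smul_eq_mul]

theorem tildeSingle_apply (l : I) (c d : C) : (j.tildeSingle l c).toLin d = j.toFun d l c :=
  tilde_single_apply j l c d

/-- The exchange formula `c₁ j(d)(c₂) = j(d₁)(c) d₂`. Applying a left linear form `g` to it turns
it into the `*C`-linearity of `j`, and such forms separate the points of `C`. -/
theorem leftDualAct_toFun (hC : IsLocallyProjective A C) (l : I) (c d : C) :
    leftDualAct (j.toFun d l) c = (j.tildeSingle l c).act d :=
  hC.dual_separating fun g => by
    change leftDualMul (j.toFun d l) g c = g (evalLeft A (j.tildeSingle l c).toLin (comulL A C d))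
    rw [← j.map_act, ← BTensor.apply_evalRight, tildeSingle_apply]
    rfl

/-- `j̃` is left `C*`-linear. -/
theorem mul_tildeSingle (hC : IsLocallyProjective A C) (f : RightDual A C) (l : I) (c : C) :
    f * j.tildeSingle l c = j.tildeSingle l (f.act c) :=
  RightDual.ext fun d => by
    rw [RightDual.toLin_mul, LinearMap.comp_apply, ← j.leftDualAct_toFun hC, tildeSingle_apply]
    exact BTensor.apply_evalRight f.toLin (j.toFun d l) (comulL A C c)

/-- The image of `j̃` consists of rational elements of the left `C*`-module `C*`. -/
theorem isRational_tilde (hC : IsLocallyProjective A C) (z : I →₀ C) :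
    IsRational A C (j.tilde z) := by
  induction z using Finsupp.induction_linear with
  | zero => exact ⟨0, fun f => by
      have : j.tilde 0 = 0 := RightDual.ext fun d => by simp [tilde_apply]
      rw [this, map_zero, smul_zero]⟩
  | add z z' hz hz' =>
    rw [tilde_add]
    exact (ratSubmodule A C (RightDual A C)).add_mem hz hz'
  | single l c =>
    refine ⟨map A LinearMap.id (j.tildeSingle l) (comulL A C c), fun f => ?_⟩
    rw [evalLeft_map_right]
    exact j.mul_tildeSingle hC f l c

/-- The exchange formula summed over `z`: `j̃(z)(d₁) d₂ = ∑ l, z_{l,1} j_l(d)(z_{l,2})`. If `j̃(z)`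
agrees with `ε` at the left factors of `Δ(d)`, the left side is `d`. -/
theorem act_tilde (hC : IsLocallyProjective A C) (z : I →₀ C) (d : C) :
    (j.tilde z).act d = z.sum fun l c => evalRight A (j.toFun d l) (comulL A C c) := by
  induction z using Finsupp.induction_linear with
  | zero =>
    have : j.tilde 0 = 0 := RightDual.ext fun d => by simp [tilde_apply]
    rw [this, RightDual.act_zero, Finsupp.sum_zero_index]
  | add z z' hz hz' =>
    rw [tilde_add, RightDual.act_add, hz, hz', Finsupp.sum_add_index' (fun l => by simp)
      (fun l x y => by simp)]
  | single l c =>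
    rw [Finsupp.sum_single_index (by simp)]
    exact (j.leftDualAct_toFun hC l c d).symm

end FrobeniusMorphism

/-- `C*` has enough rational elements: the counit can be approximated by them. -/
def HasRationalLocalUnits (A : Type u) (C : Type v) [Ring A] [AddCommGroup C] [Module A C]
    [Module Aᵐᵒᵖ C] [SMulCommClass A Aᵐᵒᵖ C] [Coring A C] : Prop :=
  ∀ S : Finset C, ∃ e : RightDual A C, IsRational A C e ∧ ∀ c ∈ S, e.toLin c = counitR A C c

namespace IsLeftLocallyQuasiFrobenius

variable {B : Type u'} [Ring B] {φ : B →+* A}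

theorem hasRationalLocalUnits (h : IsLeftLocallyQuasiFrobenius.{u, v, u', w'} φ C) :
    HasRationalLocalUnits A C := by
  obtain ⟨hC, I, j, hj⟩ := h
  intro S
  obtain ⟨z, -, hz⟩ := hj S 1 fun b c => Coring.counit_smul _ _
  exact ⟨j.tilde z, j.isRational_tilde hC z, hz⟩

/-- For `d = ε(d₁) d₂` in a finite set, density replaces `ε(d₁)` by `j̃(z)(d₁)`, and the exchange
formula gives `d = z₁ j(d)(z₂)`, a finite dual basis. -/
theorem isLocallyProjective_right (h : IsLeftLocallyQuasiFrobenius.{u, v, u', w'} φ C) :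
    IsLocallyProjective Aᵐᵒᵖ C := by
  classical
  obtain ⟨hC, I, j, hj⟩ := h
  refine isLocallyProjective_of_dualBasis fun S => ?_
  choose T hT using fun d : C => BTensor.exists_finset_evalLeft_congr (comulL A C d)
  obtain ⟨z, -, hz⟩ := hj (S.biUnion T) 1 fun b c => Coring.counit_smul _ _
  choose L hL using fun c : C => BTensor.exists_list_evalRight (comulL A C c)
  refine ⟨z.support.toList.flatMap fun l =>
    (L (z l)).map fun p => (p.1, (j.tildeSingle l p.2).toLin), fun d hd => ?_⟩
  have h1 : (j.tilde z).act d = d := (hT d _ _ fun c hc =>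
    hz c (Finset.mem_biUnion.2 ⟨d, hd, hc⟩)).trans (RightDual.act_one d)
  conv_rhs => rw [← h1, j.act_tilde hC, Finsupp.sum, ← Finset.sum_map_toList]
  induction z.support.toList with
  | nil => rfl
  | cons l ls ih =>
    rw [List.flatMap_cons, List.map_append, List.sum_append, ih, List.map_cons, List.sum_cons, hL,
      List.map_map]
    simp only [Function.comp_def, j.tildeSingle_apply]

end IsLeftLocallyQuasiFrobenius

/-! ### Rational modules -/

section RationalModules

variable {N : Type*} [AddCommGroup N] [Module A N] [Module (RightDual A C) N]

theorem IsRational.map [IsScalarTower A (RightDual A C) N] {N' : Type*} [AddCommGroup N']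
    [Module A N'] [Module (RightDual A C) N'] [IsScalarTower A (RightDual A C) N'] {n : N} (hn : IsRational A C n)
    (f : N →ₗ[RightDual A C] N') : IsRational A C (f n) := by
  obtain ⟨t, ht⟩ := hn
  refine ⟨BTensor.map A LinearMap.id (f.restrictScalars A) t, fun g => ?_⟩
  rw [evalLeft_map_right, ← ht, ← _root_.map_smul]
  rfl

/-- A rational element of a submodule is rational in the submodule: its coaction can be written
with components `f • n`, which stay in the submodule. -/
theorem IsRational.of_coe [IsScalarTower A (RightDual A C) N]
    (hC : IsLocallyProjective Aᵐᵒᵖ C) {N' : Submodule (RightDual A C) N}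
    {n : N'} (hn : IsRational A C (n : N)) : IsRational A C n := by
  obtain ⟨t, ht⟩ := hn
  obtain ⟨K, f, hK⟩ := exists_repr hC t
  refine ⟨∑ e ∈ K, tmul A e (f e • n), fun g => Subtype.ext ?_⟩
  rw [Submodule.coe_smul, ht]
  conv_lhs => rw [hK]
  simp only [map_sum, evalLeft_tmul]
  rw [Submodule.coe_sum]
  exact Finset.sum_congr rfl fun e _ => congrArg (g.toLin e • ·) (ht (f e)).symm

/-- A finitely generated rational module is finitely generated over `A`. -/
theorem finite_of_isRational (hN : ∀ n : N, IsRational A C n) [Module.Finite (RightDual A C) N] :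
    Module.Finite A N := by
  classical
  obtain ⟨S, hS⟩ := Module.Finite.fg_top (R := RightDual A C) (M := N)
  choose t ht using hN
  choose T hT using fun n : N => BTensor.exists_finset_evalLeft_mem_span (A := A) (t n)
  refine ⟨⟨S.biUnion T, eq_top_iff.2 fun x _ => ?_⟩⟩
  have hx : x ∈ Submodule.span (RightDual A C) (S : Set N) := hS ▸ Submodule.mem_top
  obtain ⟨f, -, rfl⟩ := Submodule.mem_span_finset.1 hx
  refine sum_mem fun n hn => ?_
  rw [ht n (f n)]
  exact Submodule.span_mono (Finset.coe_subset.2 (Finset.subset_biUnion_of_mem T hn))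
    (hT n (f n).toLin)

namespace HasRationalLocalUnits

theorem exists_smul_eq (hU : HasRationalLocalUnits A C) (S : Finset N)
    (hS : ∀ n ∈ S, IsRational A C n) :
    ∃ e : RightDual A C, IsRational A C e ∧ ∀ n ∈ S, e • n = n := by
  classical
  have key : ∀ n : N, ∃ T : Finset C, IsRational A C n → ∀ e : RightDual A C,
      (∀ c ∈ T, e.toLin c = counitR A C c) → e • n = n := by
    intro n
    by_cases hn : IsRational A C n
    · obtain ⟨t, ht⟩ := hn
      obtain ⟨T, hT⟩ := BTensor.exists_finset_evalLeft_congr t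
      refine ⟨T, fun _ e he => ?_⟩
      rw [ht, hT _ (1 : RightDual A C).toLin he, ← ht, one_smul]
    · exact ⟨∅, fun h => absurd h hn⟩
  choose T hT using key
  obtain ⟨e, he, h⟩ := hU (S.biUnion T)
  exact ⟨e, he, fun n hn => hT n (hS n hn) e fun c hc => h c (Finset.mem_biUnion.2 ⟨n, hn, hc⟩)⟩

/-- Rational elements lift to rational elements along surjections: if `e` is rational with
`e • n = n` and `m` lifts `n`, then `e • m` is rational and lifts `n`. -/
theorem exists_rational_lift (hU : HasRationalLocalUnits A C)
    [IsScalarTower A (RightDual A C) N] {N' : Type*} [AddCommGroup N'] [Module A N']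
    [Module (RightDual A C) N'] [IsScalarTower A (RightDual A C) N']
    (f : N →ₗ[RightDual A C] N') (hf : Function.Surjective f) {n : N'} (hn : IsRational A C n) :
    ∃ m : N, IsRational A C m ∧ f m = n := by
  obtain ⟨e, he, hen⟩ := hU.exists_smul_eq {n} (by simpa using hn)
  obtain ⟨m, rfl⟩ := hf n
  exact ⟨e • m, he.map (LinearMap.toSpanSingleton (RightDual A C) N m),
    by rw [_root_.map_smul]; exact hen _ (Finset.mem_singleton_self _)⟩

end HasRationalLocalUnits

end RationalModules

/-! ### Comodules as modules over the dual -/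

namespace LeftComodule

/-- The action `f • m = f(m₋₁) m₀` of `C*` on a left comodule. -/
instance dualModule (M : LeftComodule.{u, v, w} A C) : Module (RightDual A C) M.carrier where
  smul f m := evalLeft A f.toLin (M.coact m)
  one_smul m := M.counit m
  mul_smul f g m := by
    change evalLeft A (f * g).toLin (M.coact m) =
      evalLeft A f.toLin (M.coact (evalLeft A g.toLin (M.coact m)))
    rw [← evalLeft_map_right, ← M.coassoc, evalLeft_evalLeft_assoc, evalLeft_map_left]
    rfl
  smul_zero f := by
    change evalLeft A f.toLin (M.coact 0) = 0
    rw [map_zero, map_zero]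
  smul_add f x y := by
    change evalLeft A f.toLin (M.coact (x + y)) = _
    rw [map_add, map_add]
    rfl
  add_smul f g m := RightDual.evalLeft_add f g _
  zero_smul m := RightDual.evalLeft_zero _

theorem dual_smul_def (M : LeftComodule.{u, v, w} A C) (f : RightDual A C) (m : M.carrier) :
    f • m = evalLeft A f.toLin (M.coact m) := rfl

instance (M : LeftComodule.{u, v, w} A C) : IsScalarTower A (RightDual A C) M.carrier :=
  ⟨fun a f m => by
    have h : ∀ t : BTensor A C M.carrier, evalLeft A (a • f).toLin t = a • evalLeft A f.toLin t :=
      hom_ext A (f := evalLeft A (a • f).toLin)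
        (g := (DistribSMul.toAddMonoidHom M.carrier a).comp (evalLeft A f.toLin))
        (fun c n => by simp [mul_smul])
    exact h _⟩

theorem isRational (M : LeftComodule.{u, v, w} A C) (m : M.carrier) : IsRational A C m :=
  ⟨M.coact m, fun _ => rfl⟩

variable {M N : LeftComodule.{u, v, w} A C}

/-- A colinear map is `C*`-linear. -/
def Hom.toDualLin (f : M ⟶ N) : M.carrier →ₗ[RightDual A C] N.carrier where
  toFun := f.toLin
  map_add' := map_add f.toLin
  map_smul' g m := by
    rw [RingHom.id_apply, dual_smul_def, dual_smul_def, ← f.colinear, evalLeft_map_right]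

theorem Hom.toDualLin_injective {f g : M ⟶ N} (h : f.toDualLin = g.toDualLin) : f = g :=
  Hom.ext (LinearMap.ext fun m => LinearMap.congr_fun h m)

/-- A `C*`-linear map between comodules is colinear if `C` is locally projective on the right. -/
def homOfDualLin (hC : IsLocallyProjective Aᵐᵒᵖ C) (f : M.carrier →ₗ[RightDual A C] N.carrier) :
    M ⟶ N where
  toLin := f.restrictScalars A
  colinear m := evalLeft_separating hC fun g => by
    rw [evalLeft_map_right]
    exact f.map_smul g m

variable (A C) in
/-- The functor from left comodules to left `C*`-modules. -/
def toDualModuleCat : LeftComodule.{u, v, w} A C ⥤ ModuleCat.{w} (RightDual A C) where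
  obj M := ModuleCat.of (RightDual A C) M.carrier
  map f := ModuleCat.ofHom f.toDualLin

instance : (toDualModuleCat.{u, v, w} A C).Faithful where
  map_injective h := Hom.toDualLin_injective (congrArg ModuleCat.Hom.hom h)

theorem full_toDualModuleCat (hC : IsLocallyProjective Aᵐᵒᵖ C) :
    (toDualModuleCat.{u, v, w} A C).Full where
  map_surjective f := ⟨homOfDualLin hC f.hom, rfl⟩

end LeftComodule

section RatComodule

variable {N : Type w} [AddCommGroup N] [Module A N] [Module (RightDual A C) N]
  [IsScalarTower A (RightDual A C) N]

variable (N) in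
/-- The `C*`-action of the comodule of a rational module `N` is the given one. -/
def ratComoduleEquiv (hC : IsLocallyProjective Aᵐᵒᵖ C) (hN : ∀ n : N, IsRational A C n) :
    (ratComodule N hC hN).carrier ≃ₗ[RightDual A C] N where
  toFun n := n
  invFun n := n
  map_add' _ _ := rfl
  map_smul' f n := evalLeft_ratCoactL hC hN n f
  left_inv _ := rfl
  right_inv _ := rfl

end RatComodule

/-! ### Exactness of the rational functor -/

theorem shortExact_map_ratFunctor (hC : IsLocallyProjective Aᵐᵒᵖ C)
    (hU : HasRationalLocalUnits A C) (S : ShortComplex (ModuleCat.{w} (RightDual A C)))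
    (hS : S.ShortExact)
    [(ratFunctor.{u, v, w} A C hC ⋙ LeftComodule.toDualModuleCat A C).PreservesZeroMorphisms] :
    (S.map (ratFunctor.{u, v, w} A C hC ⋙ LeftComodule.toDualModuleCat A C)).ShortExact := by
  let := restrictModule A C S.X₁
  have := restrictModule_isScalarTower (A := A) (C := C) S.X₁
  let := restrictModule A C S.X₂
  have := restrictModule_isScalarTower (A := A) (C := C) S.X₂
  let := restrictModule A C S.X₃
  have := restrictModule_isScalarTower (A := A) (C := C) S.X₃
  have hinj : Function.Injective S.f.hom := (ModuleCat.mono_iff_injective _).1 hS.mono_f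
  have hsurj : Function.Surjective S.g.hom := (ModuleCat.epi_iff_surjective _).1 hS.epi_g
  have hex := (ShortComplex.moduleCat_exact_iff S).1 hS.exact
  refine { exact := ?_, mono_f := ?_, epi_g := ?_ }
  · refine (ShortComplex.moduleCat_exact_iff _).2 ?_
    rintro ⟨x, hx⟩ h0
    obtain ⟨y, rfl⟩ := hex x (congrArg Subtype.val h0)
    -- The preimage `y` is rational because `S.X₁` is a submodule of `S.X₂`.
    have hy : IsRational A C y := by
      have h1 : IsRational A C (⟨S.f.hom y, y, rfl⟩ : S.f.hom.range) := IsRational.of_coe hC hx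
      have h2 := h1.map (LinearEquiv.ofInjective S.f.hom hinj).symm.toLinearMap
      have h3 : (LinearEquiv.ofInjective S.f.hom hinj).symm ⟨S.f.hom y, y, rfl⟩ = y :=
        (LinearEquiv.symm_apply_eq _).2 rfl
      rwa [LinearEquiv.coe_coe, h3] at h2
    exact ⟨⟨y, hy⟩, rfl⟩
  · refine (ModuleCat.mono_iff_injective _).2 fun x y hxy => ?_
    exact Subtype.ext (hinj (congrArg Subtype.val hxy))
  · refine (ModuleCat.epi_iff_surjective _).2 ?_
    rintro ⟨x, hx⟩
    obtain ⟨y, hy, rfl⟩ := hU.exists_rational_lift S.g.hom hsurj hx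
    exact ⟨⟨y, hy⟩, rfl⟩

theorem exactFunctor_ratFunctor (hC : IsLocallyProjective Aᵐᵒᵖ C)
    (hU : HasRationalLocalUnits A C) : exactFunctor _ _ (ratFunctor.{u, v, w} A C hC) := by
  have := LeftComodule.full_toDualModuleCat.{u, v, w} hC
  have : (ratFunctor.{u, v, w} A C hC ⋙ LeftComodule.toDualModuleCat A C).Additive := ⟨rfl⟩
  obtain ⟨_, _⟩ := ((Functor.exact_tfae
    (ratFunctor.{u, v, w} A C hC ⋙ LeftComodule.toDualModuleCat A C)).out 0 3).1
    fun S hS => shortExact_map_ratFunctor hC hU S hS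
  have : Limits.ReflectsFiniteLimits (LeftComodule.toDualModuleCat.{u, v, w} A C) :=
    ⟨fun _ _ _ => inferInstance⟩
  have : Limits.ReflectsFiniteColimits (LeftComodule.toDualModuleCat.{u, v, w} A C) :=
    inferInstance
  exact ⟨Limits.preservesFiniteLimits_of_reflects_of_preserves _
      (LeftComodule.toDualModuleCat A C),
    Limits.preservesFiniteColimits_of_reflects_of_preserves _
      (LeftComodule.toDualModuleCat A C)⟩

/-! ### Projective covers of comodules -/

namespace LeftComodule

variable {M N P : LeftComodule.{u, v, w} A C}

/-- An epimorphism of comodules is surjective, because the quotient of a comodule by the image of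
a colinear map is again rational, that is, a comodule. -/
theorem epi_iff_surjective (hC : IsLocallyProjective Aᵐᵒᵖ C) (f : M ⟶ N) :
    Epi f ↔ Function.Surjective f.toLin := by
  constructor
  · intro hf
    have hQ : ∀ x : N.carrier ⧸ f.toDualLin.range, IsRational A C x := fun x => by
      obtain ⟨n, rfl⟩ := Submodule.mkQ_surjective _ x
      exact (N.isRational n).map _
    let e := ratComoduleEquiv (N.carrier ⧸ f.toDualLin.range) hC hQ
    let q : N ⟶ ratComodule _ hC hQ :=
      homOfDualLin hC (e.symm.toLinearMap ∘ₗ f.toDualLin.range.mkQ)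
    have h : q = homOfDualLin hC 0 := by
      rw [← cancel_epi f]
      refine Hom.toDualLin_injective (LinearMap.ext fun m => ?_)
      exact (Submodule.Quotient.mk_eq_zero _).2 ⟨m, rfl⟩
    intro n
    have h1 : f.toDualLin.range.mkQ n = 0 :=
      congrArg (fun k : N ⟶ ratComodule _ hC hQ => k.toLin n) h
    exact (Submodule.Quotient.mk_eq_zero _).1 h1
  · intro hf
    refine ⟨fun g k h => Hom.ext (LinearMap.ext fun n => ?_)⟩
    obtain ⟨m, rfl⟩ := hf n
    exact congrArg (fun t : M ⟶ _ => t.toLin m) h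

theorem projective_of_module (hC : IsLocallyProjective Aᵐᵒᵖ C)
    [Module.Projective (RightDual A C) P.carrier] : Projective P where
  factors {E X} f e he := by
    obtain ⟨k, hk⟩ := Module.projective_lifting_property e.toDualLin f.toDualLin
      ((epi_iff_surjective hC e).1 he)
    exact ⟨homOfDualLin hC k, Hom.toDualLin_injective hk⟩

/-- A finitely generated comodule is finitely generated over `C*`. -/
theorem IsFinitelyGenerated.finite (hC : IsLocallyProjective Aᵐᵒᵖ C)
    (hM : M.IsFinitelyGenerated) : Module.Finite (RightDual A C) M.carrier := by
  obtain ⟨S, hS⟩ := hM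
  let N := Submodule.span (RightDual A C) (S : Set M.carrier)
  have hN : ∀ n : N, IsRational A C n := fun n => (M.isRational n).of_coe hC
  let g : ratComodule N hC hN ⟶ M :=
    homOfDualLin hC (N.subtype ∘ₗ (ratComoduleEquiv N hC hN).toLinearMap)
  refine ⟨⟨S, eq_top_iff.2 fun m _ => ?_⟩⟩
  obtain ⟨n, rfl⟩ := hS _ g (fun s hs => ⟨(⟨s, Submodule.subset_span hs⟩ : N), rfl⟩) m
  exact Subtype.property (p := (· ∈ N)) n

end LeftComodule

/-- If `A` is left artinian, finitely many rational elements of a module are fixed by a rational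
idempotent of `C*`. -/
theorem HasRationalLocalUnits.exists_idempotent (hC : IsLocallyProjective Aᵐᵒᵖ C)
    (hU : HasRationalLocalUnits A C) [IsArtinianRing A] {N : Type*} [AddCommGroup N] [Module A N]
    [Module (RightDual A C) N] [IsScalarTower A (RightDual A C) N] (S : Finset N)
    (hS : ∀ n ∈ S, IsRational A C n) :
    ∃ g : RightDual A C, IsRational A C g ∧ g * g = g ∧ ∀ n ∈ S, g • n = n := by
  obtain ⟨t, ht, hfix⟩ := hU.exists_smul_eq S hS
  have hL : ∀ x ∈ Submodule.span (RightDual A C) {t}, IsRational A C x := fun x hx =>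
    (Submodule.span_singleton_le_iff_mem t (ratSubmodule A C (RightDual A C))).2 ht hx
  have := finite_of_isRational (N := Submodule.span (RightDual A C) {t})
    fun x => (hL x x.2).of_coe hC
  have : IsArtinian (RightDual A C) (Submodule.span (RightDual A C) {t}) :=
    isArtinian_of_tower A inferInstance
  have : IsNoetherian (RightDual A C) (Submodule.span (RightDual A C) {t}) :=
    isNoetherian_of_tower A inferInstance
  obtain ⟨g, hg, hgg, n, hn⟩ := exists_idempotent_mem_span_singleton t
  refine ⟨g, hL g hg, hgg, fun m hm => ?_⟩
  have hpow : ∀ k : ℕ, t ^ k • m = m := fun k => by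
    induction k with
    | zero => rw [pow_zero, one_smul]
    | succ k ih => rw [pow_succ, mul_smul, hfix m hm, ih]
  conv_lhs => rw [← hpow n, ← mul_smul, hn, hpow]

/-- If `A` is left artinian, every finitely generated rational `C*`-module is a quotient of a
finitely generated rational projective one, a finite power of `C* g` for a rational
idempotent `g`. -/
theorem HasRationalLocalUnits.exists_projective (hC : IsLocallyProjective Aᵐᵒᵖ C)
    (hU : HasRationalLocalUnits A C) [IsArtinianRing A] {N : Type*} [AddCommGroup N] [Module A N]
    [Module (RightDual A C) N] [IsScalarTower A (RightDual A C) N]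
    [Module.Finite (RightDual A C) N] (hN : ∀ n : N, IsRational A C n) :
    ∃ (k : ℕ) (P : Submodule (RightDual A C) (Fin k → RightDual A C))
      (p : P →ₗ[RightDual A C] N), Module.Projective (RightDual A C) P ∧
        Module.Finite (RightDual A C) P ∧ (∀ x : P, IsRational A C x) ∧ Function.Surjective p := by
  classical
  obtain ⟨k, s, hs⟩ := Module.Finite.exists_fin (R := RightDual A C) (M := N)
  obtain ⟨g, hg, hgg, hfix⟩ := hU.exists_idempotent hC (Finset.univ.image s) fun n _ => hN n
  -- `P` is the image of the idempotent endomorphism `x ↦ (xᵢ * g)ᵢ` of the free module.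
  let r : (Fin k → RightDual A C) →ₗ[RightDual A C] (Fin k → RightDual A C) :=
    LinearMap.pi fun i => LinearMap.toSpanSingleton (RightDual A C) (RightDual A C) g ∘ₗ
      LinearMap.proj i
  have hr : ∀ x i, r x i = x i * g := fun x i => rfl
  have hrr : ∀ x, r (r x) = r x := fun x => by
    ext1 i
    rw [hr, hr, mul_assoc, hgg]
  let F : (Fin k → RightDual A C) →ₗ[RightDual A C] N := Fintype.linearCombination _ s
  refine ⟨k, r.range, F ∘ₗ r.range.subtype, ?_, ?_, fun x => IsRational.of_coe hC ?_, ?_⟩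
  · refine Module.Projective.of_split r.range.subtype r.rangeRestrict ?_
    ext1 ⟨_, x, rfl⟩
    exact Subtype.ext (hrr x)
  · infer_instance
  · obtain ⟨_, x, rfl⟩ := x
    have hx : r x = ∑ i, LinearMap.single (RightDual A C) (fun _ : Fin k => RightDual A C) i
        (x i • g) := by
      ext1 i
      simp [hr, Pi.single_apply]
    change r x ∈ ratSubmodule A C (Fin k → RightDual A C)
    rw [hx]
    exact sum_mem fun i _ => (hg.smul (x i)).map _
  · rw [← LinearMap.range_eq_top, ← top_le_iff, ← hs, Submodule.span_le]
    rintro _ ⟨i, rfl⟩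
    refine ⟨⟨_, Pi.single i 1, rfl⟩, ?_⟩
    change F (r (Pi.single i 1)) = s i
    have h1 : r (Pi.single i 1) = Pi.single i g := by
      ext1 l
      rw [hr, Pi.single_apply, Pi.single_apply]
      split <;> simp
    rw [h1]
    simp only [F, Fintype.linearCombination_apply_single]
    exact hfix _ (Finset.mem_image_of_mem s (Finset.mem_univ i))

theorem isLeftSemiperfect_of_hasRationalLocalUnits (hC : IsLocallyProjective Aᵐᵒᵖ C)
    (hU : HasRationalLocalUnits A C) [IsArtinianRing A] : IsLeftSemiperfect A C := by
  intro M hM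
  have := hM.finite hC
  obtain ⟨k, P, p, _, _, hP, hp⟩ := hU.exists_projective hC M.isRational
  have := finite_of_isRational hP
  have : IsArtinian (RightDual A C) P := isArtinian_of_tower A inferInstance
  have : IsNoetherian (RightDual A C) P := isNoetherian_of_tower A inferInstance
  obtain ⟨P', _, hp', hmin⟩ := exists_projective_superfluous p hp
  have hP' : ∀ x : P', IsRational A C x := fun x => (hP x).of_coe hC
  let e := ratComoduleEquiv P' hC hP'
  have : Module.Projective (RightDual A C) (ratComodule P' hC hP').carrier :=
    Module.Projective.of_equiv e.symm
  let π : ratComodule P' hC hP' ⟶ M :=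
    LeftComodule.homOfDualLin hC ((p ∘ₗ P'.subtype) ∘ₗ e.toLinearMap)
  refine ⟨ratComodule P' hC hP', π, LeftComodule.projective_of_module hC,
    (LeftComodule.epi_iff_surjective hC π).2 hp', ?_⟩
  intro N g hg
  rw [LeftComodule.epi_iff_surjective hC] at hg ⊢
  let G : N.carrier →ₗ[RightDual A C] P := P'.subtype ∘ₗ e.toLinearMap ∘ₗ g.toDualLin
  have hG : G.range = P' := by
    refine hmin _ ?_ ?_
    · rintro _ ⟨x, rfl⟩
      exact (e (g.toDualLin x)).2
    · rw [← LinearMap.range_comp]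
      exact LinearMap.range_eq_top.2 hg
  intro y
  obtain ⟨x, hx⟩ := hG.ge (e y).2
  exact ⟨x, e.injective (Subtype.ext hx)⟩

end Coring

end CoringTheory

end

theorem mainTheorem8 {A : Type u} {B : Type u'} {C : Type v} [Ring A] [Ring B]
    [AddCommGroup C] [Module A C] [Module Aᵐᵒᵖ C] [SMulCommClass A Aᵐᵒᵖ C]
    [CoringTheory.Coring A C] (φ : B →+* A)
    (h : CoringTheory.IsLeftLocallyQuasiFrobenius.{u, v, u', w'} φ C) :
    (∃ hC : CoringTheory.IsLocallyProjective Aᵐᵒᵖ C,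
      exactFunctor _ _ (CoringTheory.ratFunctor.{u, v, w} A C hC)) ∧
    (CoringTheory.IsQuasiFrobenius A → CoringTheory.IsLeftSemiperfect A C) := by
  have hC := h.isLocallyProjective_right
  have hU := h.hasRationalLocalUnits
  refine ⟨⟨hC, CoringTheory.exactFunctor_ratFunctor hC hU⟩, fun hA => ?_⟩
  have : IsArtinianRing A := hA.artinian_left
  exact CoringTheory.isLeftSemiperfect_of_hasRationalLocalUnits hC hU
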